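/- Let $\mathbb B=\{0,1\}$ be the Boolean semifield ($1+1=1$). A $\mathbb B$-module is a commutative monoid $(M,+,0)$ with $x+x=x$ for all $x$. Let $\mathbb B\mathrm{mod}^{\mathfrak s}$ be the category of pairs $(M,\sigma)$ of a $\mathbb B$-module $M$ and an additive involution $\sigma$ of $M$, with the additive maps commuting with the involutions as morphisms. An object is null if $\sigma=\mathrm{id}$; a morphism $f:L\to M$ is null if $\sigma(f(x))=f(x)$ for all $x$. For $f:L\to M$ put $\mathrm{Ker}(f)=\{x\in L:\sigma(f(x))=f(x)\}$, with inclusion $\ker(f)$, and $\mathrm{Coker}(f)=M/\!\sim$, with quotient map $\mathrm{cok}(f)$, where $b\sim b'$ iff $g(b)=g(b')$ for every morphism $g$ with domain $M$ such that $g\circ f$ is null. A short doubly exact sequence is a pair $c:\ C'\xrightarrow{c'}C\xrightarrow{c''}C''$ such that $c'$ is a kernel of $c''$ and $c''$ is a cokernel of $c'$ (with respect to the null morphisms); a morphism of such sequences is a triple of morphisms making the two squares commute. Let $\mathrm{Sh}$ be an (essentially) small full subcategory of the category of short doubly exact sequences that contains all short doubly exact sequences of finite objects (for instance, the one consisting exactly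 of these). For an endofunctor $F$ of $\mathbb B\mathrm{mod}^{\mathfrak s}$, its right satellite (relative to $\mathrm{Sh}$) is the functor $$SF(X)=\varinjlim_{(c,\,x)}\mathrm{Coker}(F(c'')),$$ the colimit being taken over the comma category of pairs $(c,x)$ with $c\in\mathrm{Sh}$ and $x:C'\to X$. The functor $SF$ is null if all its values are null objects. For an object $A$, $\underline{\mathrm{Hom}}(A,-)$ is the internal Hom functor: $\underline{\mathrm{Hom}}(A,X)$ is the set of morphisms $A\to X$ with pointwise addition and the involution $f\mapsto\sigma\circ f$. (1) Let $\mathfrak s\mathbb B=\mathbb B\times\mathbb B$ and $\mathbb B^2\times\mathbb B^2=\mathfrak s(\mathbb B^2)$, each with the involution exchanging the two factors, let $\mathfrak s\Delta:\mathfrak s\mathbb B\to\mathbb B^2\times\mathbb B^2$, $(x,y)\mapsto((x,x),(y,y))$, let $Q=\mathrm{Coker}(\mathfrak s\Delta)$, $K=\mathrm{Ker}(\mathrm{cok}(\mathfrak s\Delta))$ and $F=\underline{\mathrm{Hom}}(Q,-)$. For the short doubly exact sequence $\alpha:\ K\to\mathbb B^2\times\mathbb B^2\xrightarrow{\mathrm{cok}(\mathfrak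 s\Delta)}Q$, the canonical morphism $\mathrm{Coker}(F(\mathrm{cok}(\mathfrak s\Delta)))\to SF(K)$ at the index $(\alpha,\mathrm{id}_K)$ is an isomorphism, the object $\mathrm{Coker}(F(\mathrm{cok}(\mathfrak s\Delta)))$ is not null, and the functor $SF$ is not null. (2) Let $\mathbb B^3$ be the free $\mathbb B$-module on $a,b,c$ with the involution $\sigma(a)=c$, $\sigma(b)=b$, let $\phi:\mathbb B^3\to S$ be its quotient by the relation $a+b=b+c$, with the induced involution, and let $J=\mathrm{Ker}(\phi)$ and $H=\underline{\mathrm{Hom}}(S,-)$. For the short doubly exact sequence $s:\ J\to\mathbb B^3\xrightarrow{\phi}S$, the canonical morphism $\mathrm{Coker}(H(\phi))\to SH(J)$ at the index $(s,\mathrm{id}_J)$ is an isomorphism, the object $\mathrm{Coker}(H(\phi))$ is not null, and the functor $SH$ is not null. -/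

import Mathlib

open CategoryTheory CategoryTheory.Limits

/-! ## `𝔹`-modules with involution -/

/-- The two-element `𝔹`-module `𝔹 = {0, 1}`, with `1 + 1 = 1`. -/
def BB : Type := Bool

namespace BB

instance : Finite BB := inferInstanceAs (Finite Bool)

instance : Zero BB := ⟨false⟩

instance : Add BB := ⟨Bool.or⟩

instance : AddCommMonoid BB where
  add_assoc := Bool.or_assoc
  zero_add := Bool.false_or
  add_zero := Bool.or_false
  add_comm := Bool.or_comm
  nsmul := nsmulRec

instance : One BB := ⟨true⟩

theorem add_self (x : BB) : x + x = x := Bool.or_self x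

end BB

/-- A `𝔹`-module is a commutative monoid with `x + x = x`; an object of `𝔹mod^𝔰` is a `𝔹`-module
together with an involution `σ` (an additive map with `σ ∘ σ = id`). -/
structure BModS : Type 1 where
  carrier : Type
  [inst : AddCommMonoid carrier]
  add_self : ∀ x : carrier, x + x = x
  σ : carrier →+ carrier
  σ_σ : ∀ x, σ (σ x) = x

attribute [instance] BModS.inst

namespace BModS

/-- The additive maps `M → N` commuting with the involutions. -/
def homs (M N : BModS) : AddSubmonoid (M.carrier →+ N.carrier) where
  carrier := {f | ∀ x, f (M.σ x) = N.σ (f x)}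
  zero_mem' := by intro x; simp
  add_mem' := by
    intro f g hf hg x
    simp only [Set.mem_ofPred_eq] at hf hg
    simp [hf, hg]

/-- Morphisms of `𝔹mod^𝔰`. -/
@[ext]
structure Hom (M N : BModS) : Type where
  val : homs M N

instance : Category BModS where
  Hom := Hom
  id M := ⟨⟨AddMonoidHom.id _, fun _ => rfl⟩⟩
  comp f g := ⟨⟨g.val.1.comp f.val.1, fun x => by
    simp [f.val.2 x, g.val.2 (f.val.1 x)]⟩⟩

/-- The underlying additive map of a morphism. -/
def fn {M N : BModS} (f : M ⟶ N) : M.carrier →+ N.carrier := f.val.1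

/-- Build a morphism from an equivariant additive map. -/
def mk' {M N : BModS} (f : M.carrier →+ N.carrier) (h : ∀ x, f (M.σ x) = N.σ (f x)) : M ⟶ N :=
  ⟨⟨f, h⟩⟩

@[simp] theorem fn_mk' {M N : BModS} (f : M.carrier →+ N.carrier) (h) :
    fn (mk' (M := M) (N := N) f h) = f := rfl

@[simp] theorem fn_id (M : BModS) (x : M.carrier) : fn (𝟙 M) x = x := rfl

@[simp] theorem fn_comp {L M N : BModS} (f : L ⟶ M) (g : M ⟶ N) (x : L.carrier) :
    fn (f ≫ g) x = fn g (fn f x) := rfl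

theorem fn_σ {M N : BModS} (f : M ⟶ N) (x : M.carrier) : fn f (M.σ x) = N.σ (fn f x) :=
  f.val.2 x

theorem hom_ext {M N : BModS} {f g : M ⟶ N} (h : ∀ x, fn f x = fn g x) : f = g :=
  Hom.ext (Subtype.ext (AddMonoidHom.ext h))

/-- A null object: the involution is the identity. -/
def IsNullObj (M : BModS) : Prop := ∀ x, M.σ x = x

/-- A null morphism: its values are fixed by the involution. -/
def IsNull {M N : BModS} (f : M ⟶ N) : Prop := ∀ x, N.σ (fn f x) = fn f x

/-- A null functor: all its values are null objects. -/
def IsNullFunctor (G : BModS ⥤ BModS) : Prop := ∀ X, IsNullObj (G.obj X)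

/-! ## Quotients, kernels, cokernels -/

section quotient

variable (M : BModS) (T : ∀ X : BModS, (M ⟶ X) → Prop)

/-- The congruence `a ∼ b ↔ g a = g b` for all morphisms `g` out of `M` satisfying `T`. -/
def testCon : AddCon M.carrier where
  r a b := ∀ (X : BModS) (g : M ⟶ X), T X g → fn g a = fn g b
  iseqv := ⟨fun _ _ _ _ => rfl, fun h X g hg => (h X g hg).symm,
    fun h h' X g hg => (h X g hg).trans (h' X g hg)⟩
  add' h h' X g hg := by rw [map_add, map_add, h X g hg, h' X g hg]

/-- The quotient of `M` by the congruence `testCon`, with the induced involution. -/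
def testQuot : BModS where
  carrier := (testCon M T).Quotient
  add_self x := by
    induction x using AddCon.induction_on with
    | H a => rw [← AddCon.coe_add, M.add_self]
  σ := (testCon M T).lift ((testCon M T).mk'.comp M.σ) (fun a b h => by
    refine (AddCon.eq _).2 fun X g hg => ?_
    rw [fn_σ, fn_σ]
    exact congrArg _ (h X g hg))
  σ_σ x := by
    induction x using AddCon.induction_on with
    | H a => exact congrArg _ (M.σ_σ a)

/-- The quotient map. -/
def testProj : M ⟶ testQuot M T := mk' (testCon M T).mk' (fun _ => rfl)

variable {M T}

theorem testProj_surjective : Function.Surjective (fn (testProj M T)) := AddCon.mk'_surjective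

theorem testProj_eq_iff {a b : M.carrier} : fn (testProj M T) a = fn (testProj M T) b ↔
    ∀ (X : BModS) (g : M ⟶ X), T X g → fn g a = fn g b := AddCon.eq _

/-- The morphism induced on the quotient by a morphism satisfying `T`. -/
def testDesc {X : BModS} (g : M ⟶ X) (hg : T X g) : testQuot M T ⟶ X :=
  mk' ((testCon M T).lift (fn g) (fun _ _ h => h X g hg)) (fun x => by
    induction x using AddCon.induction_on with
    | H a => exact fn_σ g a)

@[simp] theorem testDesc_fac {X : BModS} (g : M ⟶ X) (hg : T X g) (x : M.carrier) :
    fn (testDesc g hg) (fn (testProj M T) x) = fn g x := rfl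

theorem testQuot_ext {X : BModS} {g h : testQuot M T ⟶ X}
    (w : ∀ x, fn g (fn (testProj M T) x) = fn h (fn (testProj M T) x)) : g = h :=
  hom_ext fun y => by obtain ⟨x, rfl⟩ := testProj_surjective y; exact w x

end quotient

/-- `Coker f`: the quotient of `M` by `b ∼ b'` iff `g b = g b'` for all `g` with `g ∘ f` null. -/
def Coker {L M : BModS} (f : L ⟶ M) : BModS := testQuot M fun _ g => IsNull (f ≫ g)

/-- `cok f : M ⟶ Coker f`, the quotient map. -/
def cok {L M : BModS} (f : L ⟶ M) : M ⟶ Coker f := testProj M _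

/-- The factorization of `g` through `cok f` when `g ∘ f` is null. -/
def cokDesc {L M X : BModS} (f : L ⟶ M) (g : M ⟶ X) (h : IsNull (f ≫ g)) : Coker f ⟶ X :=
  testDesc g h

theorem cok_surjective {L M : BModS} (f : L ⟶ M) : Function.Surjective (fn (cok f)) :=
  testProj_surjective

theorem cok_desc {L M X : BModS} (f : L ⟶ M) (g : M ⟶ X) (h) : cok f ≫ cokDesc f g h = g := rfl

theorem cok_hom_ext {L M X : BModS} {f : L ⟶ M} {g h : Coker f ⟶ X}
    (w : cok f ≫ g = cok f ≫ h) : g = h :=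
  testQuot_ext fun x => congrArg (fun k => fn k x) w

theorem null_cok {L M : BModS} (f : L ⟶ M) : IsNull (f ≫ cok f) := fun x => by
  rw [← fn_σ]
  refine testProj_eq_iff.2 fun X g hg => ?_
  exact (fn_σ (f ≫ g) x).trans (hg x)

/-- `Ker f = {x | σ (f x) = f x}`, with the induced involution. -/
def Ker {L M : BModS} (f : L ⟶ M) : BModS where
  carrier := ({
    carrier := {x | M.σ (fn f x) = fn f x}
    zero_mem' := by simp
    add_mem' := by
      intro a b ha hb
      simp only [Set.mem_ofPred_eq] at ha hb
      simp [ha, hb] } : AddSubmonoid L.carrier)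
  add_self x := Subtype.ext (L.add_self x.1)
  σ := {
    toFun := fun x => ⟨L.σ x.1, by
      have h : M.σ (fn f x.1) = fn f x.1 := x.2
      change M.σ (fn f (L.σ x.1)) = fn f (L.σ x.1)
      rw [fn_σ, h, h]⟩
    map_zero' := Subtype.ext (map_zero L.σ)
    map_add' := fun x y => Subtype.ext (map_add L.σ x.1 y.1) }
  σ_σ x := Subtype.ext (L.σ_σ x.1)

/-- The inclusion `ker f : Ker f ⟶ L`. -/
def ker {L M : BModS} (f : L ⟶ M) : Ker f ⟶ L := mk' (AddSubmonoid.subtype _) (fun _ => rfl)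

/-- `m` is a kernel of `p` with respect to the null morphisms. -/
def IsKernel {L M N : BModS} (m : L ⟶ M) (p : M ⟶ N) : Prop :=
  IsNull (m ≫ p) ∧ ∀ (X : BModS) (g : X ⟶ M), IsNull (g ≫ p) → ∃! h : X ⟶ L, h ≫ m = g

/-- `p` is a cokernel of `m` with respect to the null morphisms. -/
def IsCokernel {L M N : BModS} (m : L ⟶ M) (p : M ⟶ N) : Prop :=
  IsNull (m ≫ p) ∧ ∀ (X : BModS) (g : M ⟶ X), IsNull (m ≫ g) → ∃! h : N ⟶ X, p ≫ h = g

theorem isKernel_ker {L M : BModS} (f : L ⟶ M) : IsKernel (ker f) f := by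
  refine ⟨fun x => x.2, fun X g hg => ⟨mk' ((fn g).codRestrict _ hg) ?_, rfl, ?_⟩⟩
  · exact fun x => Subtype.ext (fn_σ g x)
  · intro h hh
    exact hom_ext fun x => Subtype.ext (congrArg (fun k => fn k x) hh)

theorem isCokernel_cok {L M : BModS} (f : L ⟶ M) : IsCokernel f (cok f) :=
  ⟨null_cok f, fun _ g hg => ⟨cokDesc f g hg, rfl, fun _ hh => cok_hom_ext hh⟩⟩

theorem isCokernel_ker_cok {L M : BModS} (f : L ⟶ M) : IsCokernel (ker (cok f)) (cok f) := by
  refine ⟨(isKernel_ker (cok f)).1, fun X g hg => ?_⟩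
  obtain ⟨k, hk, -⟩ := (isKernel_ker (cok f)).2 _ f (null_cok f)
  refine (isCokernel_cok f).2 X g ?_
  rw [← hk, Category.assoc]
  exact fun x => hg (fn k x)

/-! ## Small colimits -/

section colimits

open DirectSum

attribute [local instance] Classical.propDecidable

variable {J : Type} [SmallCategory J] (D : J ⥤ BModS)

/-- The direct sum of the values of a small diagram. -/
noncomputable def sumObj : BModS where
  carrier := ⨁ j, (D.obj j).carrier
  add_self x := DFinsupp.ext fun j => (D.obj j).add_self (x j)
  σ := DirectSum.toAddMonoid fun j => (DirectSum.of (fun j => (D.obj j).carrier) j).comp (D.obj j).σ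
  σ_σ x := by
    induction x using DirectSum.induction_on with
    | zero => simp
    | of j x => simp [(D.obj j).σ_σ]
    | add x y hx hy => simp only [map_add, hx, hy]

/-- The inclusion of a summand. -/
noncomputable def sumIn (j : J) : D.obj j ⟶ sumObj D :=
  mk' (DirectSum.of (fun j => (D.obj j).carrier) j) (fun x =>
    (DirectSum.toAddMonoid_of (fun j => (DirectSum.of (fun j => (D.obj j).carrier) j).comp
      (D.obj j).σ) j x).symm)

theorem sumObj_ext {X : BModS} {g h : sumObj D ⟶ X} (w : ∀ j, sumIn D j ≫ g = sumIn D j ≫ h) :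
    g = h := by
  have : fn g = fn h :=
    DirectSum.addHom_ext fun j y => congrArg (fun k => fn k y) (w j)
  exact hom_ext fun x => congrArg (fun k => k x) this

/-- The additive map out of the direct sum given by a cocone. -/
noncomputable def sumAdd (s : Cocone D) : (sumObj D).carrier →+ s.pt.carrier :=
  DirectSum.toAddMonoid fun j => fn (s.ι.app j)

theorem sumAdd_in (s : Cocone D) (j : J) (y : (D.obj j).carrier) :
    sumAdd D s (fn (sumIn D j) y) = fn (s.ι.app j) y :=
  DirectSum.toAddMonoid_of (fun j => fn (s.ι.app j)) j y

theorem sumAdd_σ (s : Cocone D) : (sumAdd D s).comp (sumObj D).σ = s.pt.σ.comp (sumAdd D s) :=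
  DirectSum.addHom_ext fun j y =>
    (congrArg (sumAdd D s) (fn_σ (sumIn D j) y).symm).trans <|
      (sumAdd_in D s j _).trans <| (fn_σ (s.ι.app j) y).trans
        (congrArg s.pt.σ (sumAdd_in D s j y)).symm

/-- The morphism out of the direct sum given by a cocone. -/
noncomputable def sumDesc (s : Cocone D) : sumObj D ⟶ s.pt :=
  mk' (sumAdd D s) (fun x => congrArg (fun k => k x) (sumAdd_σ D s))

theorem sumIn_desc (s : Cocone D) (j : J) : sumIn D j ≫ sumDesc D s = s.ι.app j :=
  hom_ext fun x => DirectSum.toAddMonoid_of (fun j => fn (s.ι.app j)) j x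

/-- The colimit of a small diagram as a quotient of the direct sum. -/
noncomputable def colimCocone : Cocone D where
  pt := testQuot (sumObj D) fun _ g => ∀ ⦃i j : J⦄ (f : i ⟶ j),
    D.map f ≫ sumIn D j ≫ g = sumIn D i ≫ g
  ι := {
    app := fun j => sumIn D j ≫ testProj _ _
    naturality := fun _ _ f => hom_ext fun x =>
      testProj_eq_iff.2 fun _ _ hg => congrArg (fun k => fn k x) (hg f) }

/-- The universal property of `colimCocone`. -/
noncomputable def colimIsColimit : IsColimit (colimCocone D) where
  desc s := testDesc (sumDesc D s) (fun i j f => by rw [sumIn_desc, sumIn_desc, s.w])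
  fac s j := hom_ext fun x => congrArg (fun k => fn k x) (sumIn_desc D s j)
  uniq s m w := testQuot_ext fun x => by
    have : testProj _ _ ≫ m = sumDesc D s := sumObj_ext D fun j => by
      rw [sumIn_desc, ← w j]; rfl
    exact congrArg (fun k => fn k x) this

instance : HasColimitsOfSize.{0, 0} BModS where
  has_colimits_of_shape _ _ := ⟨fun D => ⟨⟨⟨colimCocone D, colimIsColimit D⟩⟩⟩⟩

end colimits

/-! ## Short doubly exact sequences and the right satellite -/

/-- A short doubly exact sequence `L ↣ M ↠ N`: `m = ker p` and `p = cok m`. -/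
structure Seq : Type 1 where
  L : BModS
  M : BModS
  N : BModS
  m : L ⟶ M
  p : M ⟶ N
  isKernel : IsKernel m p
  isCokernel : IsCokernel m p

/-- Morphisms of short doubly exact sequences. -/
@[ext]
structure Seq.Hom (c d : Seq) : Type where
  τL : c.L ⟶ d.L
  τM : c.M ⟶ d.M
  τN : c.N ⟶ d.N
  comm_m : c.m ≫ τM = τL ≫ d.m
  comm_p : c.p ≫ τN = τM ≫ d.p

instance : Category Seq where
  Hom := Seq.Hom
  id c := ⟨𝟙 _, 𝟙 _, 𝟙 _, by simp, by simp⟩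
  comp f g := ⟨f.τL ≫ g.τL, f.τM ≫ g.τM, f.τN ≫ g.τN,
    by rw [← Category.assoc, f.comm_m, Category.assoc, g.comm_m, Category.assoc],
    by rw [← Category.assoc, f.comm_p, Category.assoc, g.comm_p, Category.assoc]⟩

/-- The projection `P'` of a short doubly exact sequence on its left term. -/
def Seq.left : Seq ⥤ BModS where
  obj c := c.L
  map f := f.τL

/-- The functor `c ↦ Coker (F c'')` on short doubly exact sequences. -/
def cokerFunctor (F : BModS ⥤ BModS) : Seq ⥤ BModS where
  obj c := Coker (F.map c.p)
  map {c d} f := cokDesc _ (F.map f.τN ≫ cok (F.map d.p)) (by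
    rw [← Category.assoc, ← F.map_comp, f.comm_p, F.map_comp, Category.assoc]
    exact fun x => null_cok (F.map d.p) (fn (F.map f.τM) x))
  map_id c := cok_hom_ext (by rw [cok_desc, Category.comp_id]; erw [F.map_id, Category.id_comp])
  map_comp {c d e} f g := cok_hom_ext (by
    rw [cok_desc, ← Category.assoc, cok_desc, Category.assoc, cok_desc, ← Category.assoc,
      ← F.map_comp]
    rfl)

/-- The short doubly exact sequences all of whose terms are finite. -/
def finiteSeq : ObjectProperty Seq := fun c =>
  Finite c.L.carrier ∧ Finite c.M.carrier ∧ Finite c.N.carrier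

/-! The full subcategory of short doubly exact sequences of finite objects is essentially small. -/

/-- The set `Fin n` without its arithmetic. -/
def FinSet (n : ℕ) : Type := Fin n

/-- An object with underlying set `Fin n`. -/
structure FinCode : Type where
  n : ℕ
  inst : AddCommMonoid (FinSet n)
  add_self : ∀ x : FinSet n, x + x = x
  σ : FinSet n →+ FinSet n
  σ_σ : ∀ x, σ (σ x) = x

/-- The object of `𝔹mod^𝔰` given by a code. -/
def FinCode.obj (d : FinCode) : BModS :=
  letI := d.inst
  ⟨FinSet d.n, d.add_self, d.σ, d.σ_σ⟩

theorem exists_finCode (M : BModS) [Finite M.carrier] : ∃ d : FinCode, Nonempty (d.obj ≅ M) := by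
  obtain ⟨n, ⟨f'⟩⟩ := Finite.exists_equiv_fin M.carrier
  let f : M.carrier ≃ FinSet n := f'
  let inst : AddCommMonoid (FinSet n) := f.symm.addCommMonoid
  let g : FinSet n ≃+ M.carrier := { f.symm with map_add' := fun x y => f.symm_apply_apply _ }
  let d : FinCode := ⟨n, inst,
    fun x => g.injective (by rw [map_add, M.add_self]),
    (g.symm.toAddMonoidHom.comp M.σ).comp g.toAddMonoidHom,
    fun x => by
      change g.symm (M.σ (g (g.symm (M.σ (g x))))) = x
      rw [g.apply_symm_apply, M.σ_σ, g.symm_apply_apply]⟩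
  refine ⟨d, ⟨⟨mk' (M := d.obj) (N := M) g.toAddMonoidHom (fun x => ?_),
    mk' (M := M) (N := d.obj) g.symm.toAddMonoidHom (fun x => ?_), ?_, ?_⟩⟩⟩
  · exact g.apply_symm_apply (M.σ (g x))
  · change g.symm (M.σ x) = g.symm (M.σ (g (g.symm x)))
    rw [g.apply_symm_apply]
  · exact hom_ext fun x => g.symm_apply_apply x
  · exact hom_ext fun x => g.apply_symm_apply x

theorem isNull_comp_left {L M N : BModS} (f : L ⟶ M) {g : M ⟶ N} (h : IsNull g) :
    IsNull (f ≫ g) := fun x => h (fn f x)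

theorem isNull_comp_right {L M N : BModS} {f : L ⟶ M} (h : IsNull f) (g : M ⟶ N) :
    IsNull (f ≫ g) := fun x => (fn_σ g _).symm.trans (congrArg (fn g) (h x))

theorem IsKernel.of_iso {L M N L' M' N' : BModS} {m : L ⟶ M} {p : M ⟶ N} (h : IsKernel m p)
    (a : L' ≅ L) (b : M' ≅ M) (c : N' ≅ N) : IsKernel (a.hom ≫ m ≫ b.inv) (b.hom ≫ p ≫ c.inv) := by
  refine ⟨?_, fun X g hg => ?_⟩
  · have := isNull_comp_left a.hom (isNull_comp_right h.1 c.inv)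
    simpa using this
  · obtain ⟨k, hk, hu⟩ := h.2 X (g ≫ b.hom) (by simpa using isNull_comp_right hg c.hom)
    refine ⟨k ≫ a.inv, ?_, fun k' hk' => ?_⟩
    · simp [reassoc_of% hk]
    · rw [Iso.eq_comp_inv]
      exact hu _ (by simp [← hk'])

theorem IsCokernel.of_iso {L M N L' M' N' : BModS} {m : L ⟶ M} {p : M ⟶ N} (h : IsCokernel m p)
    (a : L' ≅ L) (b : M' ≅ M) (c : N' ≅ N) :
    IsCokernel (a.hom ≫ m ≫ b.inv) (b.hom ≫ p ≫ c.inv) := by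
  refine ⟨?_, fun X g hg => ?_⟩
  · have := isNull_comp_left a.hom (isNull_comp_right h.1 c.inv)
    simpa using this
  · obtain ⟨k, hk, hu⟩ := h.2 X (b.inv ≫ g) (by simpa using isNull_comp_left a.inv hg)
    refine ⟨c.hom ≫ k, ?_, fun k' hk' => ?_⟩
    · simp [hk]
    · rw [← Iso.inv_comp_eq]
      exact hu _ (by simp [← hk'])

/-- A short doubly exact sequence whose terms have underlying sets `Fin n`. -/
structure SeqCode : Type where
  L : FinCode
  M : FinCode
  N : FinCode
  m : L.obj ⟶ M.obj
  p : M.obj ⟶ N.obj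
  isKernel : IsKernel m p
  isCokernel : IsCokernel m p

/-- The short doubly exact sequence given by a code. -/
def SeqCode.seq (d : SeqCode) : Seq :=
  ⟨d.L.obj, d.M.obj, d.N.obj, d.m, d.p, d.isKernel, d.isCokernel⟩

instance essentiallySmall_finiteSeq : ObjectProperty.EssentiallySmall.{0} finiteSeq := by
  refine ⟨ObjectProperty.ofObj SeqCode.seq, inferInstance, fun c hc => ?_⟩
  obtain ⟨h1, h2, h3⟩ := hc
  obtain ⟨l, ⟨a⟩⟩ := exists_finCode c.L
  obtain ⟨k, ⟨b⟩⟩ := exists_finCode c.M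
  obtain ⟨n, ⟨e⟩⟩ := exists_finCode c.N
  let d : SeqCode := ⟨l, k, n, _, _, c.isKernel.of_iso a b e, c.isCokernel.of_iso a b e⟩
  let F : d.seq ⟶ c := (⟨a.hom, b.hom, e.hom, by simp [d, SeqCode.seq], by simp [d, SeqCode.seq]⟩ :
    Seq.Hom _ _)
  let G : c ⟶ d.seq := (⟨a.inv, b.inv, e.inv, by simp [d, SeqCode.seq], by simp [d, SeqCode.seq]⟩ :
    Seq.Hom _ _)
  refine ⟨d.seq, ⟨d⟩, ⟨⟨G, F, ?_, ?_⟩⟩⟩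
  · exact Seq.Hom.ext a.inv_hom_id b.inv_hom_id e.inv_hom_id
  · exact Seq.Hom.ext a.hom_inv_id b.hom_inv_id e.hom_inv_id

instance hasSatellite (P : ObjectProperty Seq) [ObjectProperty.EssentiallySmall.{0} P]
    (F : BModS ⥤ BModS) :
    (P.ι ⋙ Seq.left).HasPointwiseLeftKanExtension (P.ι ⋙ cokerFunctor F) := fun X => by
  have : EssentiallySmall.{0} (CostructuredArrow (P.ι ⋙ Seq.left) X) := inferInstance
  have : HasColimitsOfShape (CostructuredArrow (P.ι ⋙ Seq.left) X) BModS :=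
    hasColimitsOfShape_of_essentiallySmall.{0} _ _
  exact inferInstanceAs (HasColimit _)

/-- The right satellite of `F` relative to the full subcategory of short doubly exact sequences
given by `P`: `SF(X)` is the colimit of `Coker (F c'')` over the comma category of pairs
`(c, x)`, with `c` in `P` and `x : c' ⟶ X`. -/
noncomputable def satellite (P : ObjectProperty Seq) [ObjectProperty.EssentiallySmall.{0} P]
    (F : BModS ⥤ BModS) : BModS ⥤ BModS :=
  (P.ι ⋙ Seq.left).pointwiseLeftKanExtension (P.ι ⋙ cokerFunctor F)

/-- The canonical map `Coker (F c'') ⟶ SF(c')` into the colimit, at the index `(c, id)`. -/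
noncomputable def satelliteMap (P : ObjectProperty Seq) [ObjectProperty.EssentiallySmall.{0} P]
    (F : BModS ⥤ BModS) (c : Seq) (hc : P c) : Coker (F.map c.p) ⟶ (satellite P F).obj c.L :=
  colimit.ι (CostructuredArrow.proj (P.ι ⋙ Seq.left) c.L ⋙ P.ι ⋙ cokerFunctor F)
    (CostructuredArrow.mk (S := P.ι ⋙ Seq.left) (T := c.L) (Y := (⟨c, hc⟩ : P.FullSubcategory))
      (show (P.ι ⋙ Seq.left).obj (⟨c, hc⟩ : P.FullSubcategory) ⟶ c.L from 𝟙 c.L))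

/-- The internal Hom functor `Hom(A, -)`: addition is pointwise, the involution is `f ↦ σ ∘ f`. -/
def iHom (A : BModS) : BModS ⥤ BModS where
  obj X := {
    carrier := homs A X
    add_self := fun f => Subtype.ext (AddMonoidHom.ext fun x => X.add_self (f.1 x))
    σ := {
      toFun := fun f => ⟨X.σ.comp f.1, fun x => congrArg X.σ (f.2 x)⟩
      map_zero' := Subtype.ext (AddMonoidHom.ext fun _ => map_zero X.σ)
      map_add' := fun f g => Subtype.ext (AddMonoidHom.ext fun x => map_add X.σ (f.1 x) (g.1 x)) }
    σ_σ := fun f => Subtype.ext (AddMonoidHom.ext fun x => X.σ_σ (f.1 x)) }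
  map h := mk' {
      toFun := fun f => ⟨(fn h).comp f.1, fun x =>
        (congrArg (fn h) (f.2 x)).trans (fn_σ h (f.1 x))⟩
      map_zero' := Subtype.ext (AddMonoidHom.ext fun _ => map_zero (fn h))
      map_add' := fun f g =>
        Subtype.ext (AddMonoidHom.ext fun x => map_add (fn h) (f.1 x) (g.1 x)) }
    (fun f => Subtype.ext (AddMonoidHom.ext fun x => fn_σ h (f.1 x)))
  map_id _ := rfl
  map_comp _ _ := rfl

/-! ## The two sequences -/

/-- `𝔰 N = (N × N, swap)` for a `𝔹`-module `N`. -/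
def sObj (N : Type) [AddCommMonoid N] (hN : ∀ x : N, x + x = x) : BModS where
  carrier := N × N
  add_self _ := Prod.ext (hN _) (hN _)
  σ := (AddMonoidHom.snd N N).prod (AddMonoidHom.fst N N)
  σ_σ _ := rfl

/-- `𝔰 f = f × f` for a morphism `f` of `𝔹`-modules. -/
def sMap {N N' : Type} [AddCommMonoid N] [AddCommMonoid N'] (hN : ∀ x : N, x + x = x)
    (hN' : ∀ x : N', x + x = x) (f : N →+ N') : sObj N hN ⟶ sObj N' hN' :=
  mk' (f.prodMap f) (fun _ => rfl)

/-- `𝔹² × 𝔹² = 𝔰(𝔹 × 𝔹)`. -/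
def B22 : BModS := sObj (BB × BB) (fun _ => Prod.ext (BB.add_self _) (BB.add_self _))

/-- `𝔰Δ : 𝔰𝔹 ⟶ 𝔰(𝔹 × 𝔹)` for the diagonal `Δ : 𝔹 → 𝔹 × 𝔹`. -/
def sDiag : sObj BB BB.add_self ⟶ B22 :=
  sMap _ _ ((AddMonoidHom.id BB).prod (AddMonoidHom.id BB))

/-- `Q = Coker(𝔰Δ)`. -/
def Q : BModS := Coker sDiag

/-- `K = Ker(cok(𝔰Δ))`. -/
def K : BModS := Ker (cok sDiag)

/-- The short doubly exact sequence `K ↣ 𝔹² × 𝔹² ↠ Q`. -/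
def seqQ : Seq where
  L := K
  M := B22
  N := Q
  m := ker (cok sDiag)
  p := cok sDiag
  isKernel := isKernel_ker _
  isCokernel := isCokernel_ker_cok _

/-- `𝔹³`, free on `a = e₀`, `b = e₁`, `c = e₂`, with `σ a = c`, `σ b = b`. -/
def B3 : BModS where
  carrier := Fin 3 → BB
  add_self x := funext fun i => BB.add_self (x i)
  σ := {
    toFun := fun x i => x i.rev
    map_zero' := rfl
    map_add' := fun _ _ => rfl }
  σ_σ x := funext fun i => congrArg x (Fin.rev_rev i)

/-- The generators of `𝔹³`. -/
def e (i : Fin 3) : B3.carrier := (Pi.single i 1 : Fin 3 → BB)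

/-- The quotient `S` of `𝔹³` by the relation `a + b = b + c`. -/
def S : BModS := testQuot B3 fun _ g => fn g (e 0 + e 1) = fn g (e 1 + e 2)

/-- The quotient map `φ : 𝔹³ ⟶ S`. -/
def φ : B3 ⟶ S := testProj B3 _

theorem B3_σ : B3.σ (e 0 + e 1) = e 1 + e 2 := by
  funext i
  fin_cases i <;> rfl

theorem isCokernel_ker_φ : IsCokernel (ker φ) φ := by
  have h0 : fn φ (e 0 + e 1) = fn φ (e 1 + e 2) := testProj_eq_iff.2 fun _ _ h => h
  refine ⟨(isKernel_ker φ).1, fun X g hg => ⟨testDesc g ?_, rfl, ?_⟩⟩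
  · have hk : S.σ (fn φ (e 0 + e 1)) = fn φ (e 0 + e 1) := by
      rw [← fn_σ, B3_σ, h0]
    have := hg ⟨e 0 + e 1, hk⟩
    rw [← B3_σ, fn_σ]
    exact this.symm
  · intro h hh
    exact testQuot_ext fun x => congrArg (fun k => fn k x) hh

/-- The short doubly exact sequence `J ↣ 𝔹³ ↠ S`, with `J = Ker φ`. -/
def seqS : Seq where
  L := Ker φ
  M := B3
  N := S
  m := ker φ
  p := φ
  isKernel := isKernel_ker φ
  isCokernel := isCokernel_ker_φ

theorem finite_testQuot (M : BModS) (T) [Finite M.carrier] : Finite (testQuot M T).carrier :=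
  Finite.of_surjective _ (testProj_surjective (M := M) (T := T))

theorem finite_ker {L M : BModS} (f : L ⟶ M) [Finite L.carrier] : Finite (Ker f).carrier :=
  Finite.of_injective (fun x : (Ker f).carrier => fn (ker f) x) Subtype.val_injective

theorem finiteSeq_seqQ : finiteSeq seqQ := by
  have : Finite B22.carrier := inferInstanceAs (Finite ((BB × BB) × (BB × BB)))
  exact ⟨finite_ker _, this, finite_testQuot _ _⟩

theorem finiteSeq_seqS : finiteSeq seqS := by
  have : Finite B3.carrier := inferInstanceAs (Finite (Fin 3 → BB))
  exact ⟨finite_ker _, this, finite_testQuot _ _⟩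

end BModS

/-! ## Boolean arithmetic -/

namespace BB

/-! Write `x ≤ y` for `x + y = y`. Both sequences have the shape `L → M → N` with `M` a permutation
module (finite free, basis permuted by `σ`) and `N` the quotient of `M` by one relation `r = σ r`;
`Presentation` records what is needed, and both claims are proved for it.

The satellite. Permutation modules are injective (`exists_extend`), so every `c' → L` extends to a
morphism of sequences `c → α`. If extensions with the same left term induce the same map on `Coker
(F c'')`, then `(α, id)` acts as a terminal index and the colimit is its value. As `M` is also
projective (`exists_lift`), this reduces to endomorphisms `f`, `g` of `α` with equal left terms
(`cok_eq_of_left_eq`). They agree on `Ker p`, so share `k = f r = g r`. The map `f ∧ k ∧ σ k` sends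
`r` to a fixed element, hence factors through `N`; in the cokernel it may be replaced by its
conjugate. So `f` has the class of `f + σ (f ∧ k ∧ σ k)`, and on `y ≤ r` this equals `f (y + σ y) ∧
k`, which only involves `f` on `Ker p`.

Non-nullity. If `y : N → M` satisfies `p y ≤ id`, then `σ y = y` (`σ_eq_of_comp_le_id`). Hence the
character of `Hom(N, N)` vanishing exactly below `id`, paired with its conjugate, is a test morphism
for the cokernel. It separates `id` from `σ`, so the class of `id` is not fixed. -/

instance : DecidableEq BB := inferInstanceAs (DecidableEq Bool)

instance : Fintype BB := inferInstanceAs (Fintype Bool)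

/-- The product of `𝔹`. -/
def and (x y : BB) : BB := Bool.and x y

theorem eq_zero_or_one : ∀ x : BB, x = 0 ∨ x = 1 := by decide

theorem one_ne_zero : (1 : BB) ≠ 0 := by decide

theorem add_eq_zero : ∀ x y : BB, x + y = 0 ↔ x = 0 ∧ y = 0 := by decide

theorem zero_and : ∀ x : BB, and 0 x = 0 := by decide

theorem add_and : ∀ x y z : BB, and (x + y) z = and x z + and y z := by decide

theorem and_add_self : ∀ x y : BB, and x y + x = x := by decide

theorem and_comm : ∀ x y : BB, and x y = and y x := by decide

theorem and_and_self : ∀ x y : BB, and x (and x y) = and x y := by decide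

theorem add_one : ∀ x : BB, x + 1 = 1 := by decide

theorem one_add : ∀ x : BB, 1 + x = 1 := by decide

/-- Both sides are the meet of `v + v'` with `k`. -/
theorem symmetrized_eq : ∀ v v' w w' k k' : BB, v + k = k → v' + k' = k' → w + k = k →
    w' + k' = k' → v + v' = w + w' → v + and v' (and k' k) = w + and w' (and k' k) := by decide

/-- The additive map `𝔹 → A` with value `a` at `1`, when `a + a = a`. -/
def toHom {A : Type*} [AddCommMonoid A] (a : A) (h : a + a = a) : BB →+ A where
  toFun x := if x = 1 then a else 0
  map_zero' := if_neg one_ne_zero.symm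
  map_add' x y := by
    rcases eq_zero_or_one x with rfl | rfl <;> rcases eq_zero_or_one y with rfl | rfl <;>
      simp [add_self, one_ne_zero.symm, h]

@[simp] theorem toHom_one {A : Type*} [AddCommMonoid A] (a : A) (h : a + a = a) :
    toHom a h 1 = a := show (if (1 : BB) = 1 then a else 0) = a from if_pos rfl

theorem hom_ext {A : Type*} [AddCommMonoid A] {f g : BB →+ A} (h : f 1 = g 1) : f = g := by
  ext x
  rcases eq_zero_or_one x with rfl | rfl
  · simp
  · exact h

open Classical in
/-- `𝔹` is injective: the largest extension of `h` along `m`. -/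
noncomputable def extend {A B : Type*} [AddCommMonoid A] [AddCommMonoid B]
    (hB : ∀ y : B, y + y = y) (m : A →+ B) (h : A →+ BB) : B →+ BB where
  -- The value is `0` only where additivity and monotonicity force it: on elements below some `m l`
  -- with `h l = 0`.
  toFun y := if ∃ l, h l = 0 ∧ y + m l = m l then (0 : BB) else 1
  map_zero' := if_pos ⟨0, by simp⟩
  map_add' y z := by
    have left : ∀ y z, (∃ l, h l = 0 ∧ y + z + m l = m l) → ∃ l, h l = 0 ∧ y + m l = m l := by
      rintro y z ⟨l, h1, h2⟩
      refine ⟨l, h1, ?_⟩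
      rw [← h2, add_assoc, ← add_assoc, hB]
    have right : (∃ l, h l = 0 ∧ y + z + m l = m l) → ∃ l, h l = 0 ∧ z + m l = m l := by
      rw [add_comm y z]
      exact left z y
    by_cases hy : ∃ l, h l = 0 ∧ y + m l = m l
    · by_cases hz : ∃ l, h l = 0 ∧ z + m l = m l
      · rw [if_pos hy, if_pos hz, if_pos, add_self]
        obtain ⟨l, h1, h2⟩ := hy
        obtain ⟨k, h3, h4⟩ := hz
        exact ⟨l + k, by simp [h1, h3], by rw [map_add, add_add_add_comm, h2, h4]⟩
      · rw [if_pos hy, if_neg hz, if_neg (mt right hz), zero_add]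
    · rw [if_neg hy, if_neg (mt (left y z) hy)]
      split_ifs <;> rfl

open Classical in
theorem extend_eq_zero_iff {A B : Type*} [AddCommMonoid A] [AddCommMonoid B]
    (hB : ∀ y : B, y + y = y) (m : A →+ B) (h : A →+ BB) (y : B) :
    extend hB m h y = 0 ↔ ∃ l, h l = 0 ∧ y + m l = m l := by
  change (if ∃ l, h l = 0 ∧ y + m l = m l then (0 : BB) else 1) = 0 ↔ _
  by_cases hy : ∃ l, h l = 0 ∧ y + m l = m l
  · rw [if_pos hy]
    exact iff_of_true rfl hy
  · rw [if_neg hy]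
    exact iff_of_false one_ne_zero hy

theorem eq_of_zero_iff : ∀ {x y : BB}, (x = 0 ↔ y = 0) → x = y := by decide

theorem extend_apply {A B : Type*} [AddCommMonoid A] [AddCommMonoid B]
    (hB : ∀ y : B, y + y = y) (m : A →+ B) (hm : Function.Injective m) (h : A →+ BB) (a : A) :
    extend hB m h (m a) = h a := by
  refine eq_of_zero_iff ?_
  rw [extend_eq_zero_iff]
  constructor
  · rintro ⟨l, h1, h2⟩
    have h3 : a + l = l := hm (by rw [map_add, h2])
    exact ((add_eq_zero (h a) (h l)).1 (by rw [← map_add, h3, h1])).1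
  · exact fun h1 => ⟨a, h1, hB _⟩

end BB

namespace BModS

/-! ## Short doubly exact sequences -/

theorem IsKernel.exists_of_fixed {L M N : BModS} {m : L ⟶ M} {p : M ⟶ N} (h : IsKernel m p)
    {x : M.carrier} (hx : N.σ (fn p x) = fn p x) : ∃ l, fn m l = x := by
  obtain ⟨k, hk, -⟩ := h.2 _ (ker p) (isKernel_ker p).1
  let z : (Ker p).carrier := ⟨x, hx⟩
  exact ⟨fn k z, congrArg (fun t => fn t z) hk⟩

/-- By uniqueness of factorizations, `m` is identified with the concrete inclusion `ker p`. -/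
theorem IsKernel.injective {L M N : BModS} {m : L ⟶ M} {p : M ⟶ N} (h : IsKernel m p) :
    Function.Injective (fn m) := by
  obtain ⟨k, hk, -⟩ := h.2 _ (ker p) (isKernel_ker p).1
  obtain ⟨j, hj, -⟩ := (isKernel_ker p).2 _ m h.1
  have hjk : j ≫ k = 𝟙 L :=
    (h.2 _ m h.1).unique (by rw [Category.assoc, hk, hj]) (Category.id_comp m)
  intro a b hab
  have hab' : fn j a = fn j b := Subtype.ext <| by
    have ha : fn (ker p) (fn j a) = fn m a := congrArg (fun t => fn t a) hj
    have hb : fn (ker p) (fn j b) = fn m b := congrArg (fun t => fn t b) hj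
    exact ha.trans (hab.trans hb.symm)
  have ha : fn k (fn j a) = a := congrArg (fun t => fn t a) hjk
  have hb : fn k (fn j b) = b := congrArg (fun t => fn t b) hjk
  rw [← ha, ← hb, hab']

theorem IsCokernel.surjective {L M N : BModS} {m : L ⟶ M} {p : M ⟶ N} (h : IsCokernel m p) :
    Function.Surjective (fn p) := by
  obtain ⟨k, hk, -⟩ := h.2 _ (cok m) (null_cok m)
  have hkd : k ≫ cokDesc m p h.1 = 𝟙 N :=
    (h.2 _ p h.1).unique (by rw [← Category.assoc, hk, cok_desc]) (Category.comp_id p)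
  intro n
  obtain ⟨y, hy⟩ := cok_surjective m (fn k n)
  refine ⟨y, ?_⟩
  have h1 : fn (cokDesc m p h.1) (fn k n) = n := congrArg (fun t => fn t n) hkd
  rw [← h1, ← hy]
  rfl

/-- A morphism of middle terms restricting to the left terms extends to the sequences. -/
theorem Seq.exists_hom_of_left {c d : Seq} (l : c.L ⟶ d.L) (f : c.M ⟶ d.M)
    (h : c.m ≫ f = l ≫ d.m) : ∃ g : Seq.Hom c d, g.τL = l ∧ g.τM = f := by
  obtain ⟨n, hn, -⟩ := c.isCokernel.2 _ (f ≫ d.p) (by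
    rw [← Category.assoc, h, Category.assoc]
    exact isNull_comp_left l d.isKernel.1)
  exact ⟨⟨l, f, n, h, hn⟩, rfl, rfl⟩

/-- A morphism of middle terms inducing one of the right terms extends to the sequences. -/
theorem Seq.exists_hom_of_right {c d : Seq} (n : c.N ⟶ d.N) (f : c.M ⟶ d.M)
    (h : c.p ≫ n = f ≫ d.p) : ∃ g : Seq.Hom c d, g.τN = n ∧ g.τM = f := by
  obtain ⟨l, hl, -⟩ := d.isKernel.2 _ (c.m ≫ f) (by
    rw [Category.assoc, ← h, ← Category.assoc]
    exact isNull_comp_right c.isKernel.1 n)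
  exact ⟨⟨l, f, n, hl.symm, h⟩, rfl, rfl⟩

/-! ## The satellite at a semi-injective sequence -/

/-- If every morphism `c' ⟶ α'` extends to `c ⟶ α`, and the induced morphism on the values of
`cokerFunctor F` does not depend on the extension, then `SF(α')` is `Coker (F α'')`. -/
theorem isIso_satelliteMap (P : ObjectProperty Seq) [ObjectProperty.EssentiallySmall.{0} P]
    (F : BModS ⥤ BModS) (α : Seq) (hα : P α)
    (ext : ∀ (c : Seq) (x : c.L ⟶ α.L), ∃ f : c ⟶ α, f.τL = x)
    (indep : ∀ (c : Seq) (f g : c ⟶ α), f.τL = g.τL →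
      (cokerFunctor F).map f = (cokerFunctor F).map g) :
    IsIso (satelliteMap P F α hα) := by
  choose f hf using ext
  let D := CostructuredArrow.proj (P.ι ⋙ Seq.left) α.L ⋙ P.ι ⋙ cokerFunctor F
  have hD : HasColimit D := hasSatellite P F α.L
  -- The legs use arbitrarily chosen extensions; naturality holds because both composites extend the
  -- same left map.
  let s : Cocone D :=
    { pt := Coker (F.map α.p)
      ι :=
        { app := fun j => (cokerFunctor F).map (f j.left.obj j.hom)
          naturality := fun i j t => by
            have hw : t.left.hom.τL ≫ j.hom = i.hom := CostructuredArrow.w t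
            refine Eq.trans ?_ (Category.comp_id _).symm
            change (cokerFunctor F).map t.left.hom ≫ _ = _
            refine ((cokerFunctor F).map_comp _ _).symm.trans ?_
            refine indep _ _ _ ?_
            change t.left.hom.τL ≫ (f j.left.obj j.hom).τL = _
            exact (congrArg (_ ≫ ·) (hf _ _)).trans (hw.trans (hf _ _).symm) } }
  refine ⟨colimit.desc D s, ?_, ?_⟩
  · refine (colimit.ι_desc s _).trans ?_
    refine (indep α _ (𝟙 α) ?_).trans ((cokerFunctor F).map_id α)
    exact hf _ _
  · refine colimit.hom_ext (F := D) fun j => ?_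
    refine (Category.assoc _ _ _).symm.trans ?_
    refine (congrArg (· ≫ satelliteMap P F α hα) (colimit.ι_desc s j)).trans ?_
    refine Eq.trans ?_ (Category.comp_id _).symm
    let j0 : CostructuredArrow (P.ι ⋙ Seq.left) α.L :=
      CostructuredArrow.mk (S := P.ι ⋙ Seq.left) (T := α.L)
        (Y := (⟨α, hα⟩ : P.FullSubcategory)) (𝟙 α.L)
    -- The chosen extension is itself an arrow of the comma category to `(α, id)`, so the leg at `j`
    -- factors through the one at `(α, id)`.
    let t : j ⟶ j0 := CostructuredArrow.homMk
      (ObjectProperty.homMk (f j.left.obj j.hom)) (by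
        refine (Category.comp_id _).trans ?_
        exact hf _ _)
    exact colimit.w D t

theorem isNullObj_of_iso {M N : BModS} (i : M ≅ N) (h : IsNullObj N) : IsNullObj M := fun x => by
  have hx : ∀ x, fn i.inv (fn i.hom x) = x := fun x => congrArg (fun t => fn t x) i.hom_inv_id
  rw [← hx (M.σ x), fn_σ, h, hx]

end BModS

namespace BModS

/-! ## Permutation modules -/

/-- Coordinates on `M` in which the involution permutes a finite basis by `τ`. -/
structure PermCoords (M : BModS) where
  X : Type
  [fintype : Fintype X]
  [decEq : DecidableEq X]
  τ : X → X
  τ_τ : ∀ i, τ (τ i) = i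
  E : M.carrier ≃+ (X → BB)
  E_σ : ∀ x i, E (M.σ x) i = E x (τ i)

attribute [instance] PermCoords.fintype PermCoords.decEq

namespace PermCoords

variable {M : BModS} (C : PermCoords M)

/-- The basis element with index `i`. -/
def gen (i : C.X) : M.carrier := C.E.symm (Pi.single i 1)

theorem ext {x y : M.carrier} (h : ∀ i, C.E x i = C.E y i) : x = y :=
  C.E.injective (funext h)

theorem E_gen_self (i : C.X) : C.E (C.gen i) i = 1 := by
  simp [gen]

theorem E_gen_ne {i j : C.X} (h : j ≠ i) : C.E (C.gen i) j = 0 := by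
  simp [gen, h]

theorem σ_gen (i : C.X) : M.σ (C.gen i) = C.gen (C.τ i) := by
  refine C.ext fun j => ?_
  rw [C.E_σ]
  by_cases h : j = C.τ i
  · rw [h, C.τ_τ, E_gen_self, E_gen_self]
  · rw [C.E_gen_ne h, C.E_gen_ne]
    rintro rfl
    exact h (C.τ_τ j).symm

theorem hom_ext {A : Type*} [AddCommMonoid A] {f g : M.carrier →+ A}
    (h : ∀ i, f (C.gen i) = g (C.gen i)) : f = g := by
  have : f.comp C.E.symm.toAddMonoidHom = g.comp C.E.symm.toAddMonoidHom :=
    AddMonoidHom.functions_ext' _ _ _ fun i => BB.hom_ext (h i)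
  ext x
  have hx := DFunLike.congr_fun this (C.E x)
  simpa using hx

theorem add_gen_of_apply_eq_one {x : M.carrier} {i : C.X} (h : C.E x i = 1) :
    C.gen i + x = x := by
  refine C.ext fun j => ?_
  rw [map_add, Pi.add_apply]
  by_cases hj : j = i
  · rw [hj, h, BB.add_one]
  · rw [C.E_gen_ne hj, zero_add]

/-- The morphism with prescribed values on the basis. -/
def lift {Y : BModS} (t : C.X → Y.carrier) (ht : ∀ i, t (C.τ i) = Y.σ (t i)) : M ⟶ Y :=
  mk' ((∑ i, (BB.toHom (t i) (Y.add_self _)).comp (Pi.evalAddMonoidHom (fun _ => BB) i)).comp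
    C.E.toAddMonoidHom) (fun x => by
      have : ∀ x : M.carrier, ((∑ i, (BB.toHom (t i) (Y.add_self _)).comp
          (Pi.evalAddMonoidHom (fun _ => BB) i)).comp C.E.toAddMonoidHom) x =
          ∑ i, BB.toHom (t i) (Y.add_self _) (C.E x i) := fun x => by
        simp [AddMonoidHom.finsetSum_apply]
      rw [this, this, map_sum]
      refine Fintype.sum_equiv (Function.Involutive.toPerm C.τ (show Function.Involutive C.τ from C.τ_τ)) _ _ fun i => ?_
      change BB.toHom (t i) _ (C.E (M.σ x) i) =
        Y.σ (BB.toHom (t (C.τ i)) _ (C.E x (C.τ i)))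
      rw [C.E_σ]
      rcases BB.eq_zero_or_one (C.E x (C.τ i)) with h | h
      · simp [h]
      · rw [h]
        simp only [BB.toHom_one, ht, Y.σ_σ])

theorem lift_gen {Y : BModS} (t : C.X → Y.carrier) (ht : ∀ i, t (C.τ i) = Y.σ (t i)) (i : C.X) :
    fn (C.lift t ht) (C.gen i) = t i := by
  change ((∑ i, (BB.toHom (t i) (Y.add_self _)).comp
          (Pi.evalAddMonoidHom (fun _ => BB) i)).comp C.E.toAddMonoidHom) (C.gen i) = _
  simp only [AddMonoidHom.comp_apply, AddMonoidHom.finsetSum_apply]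
  rw [Finset.sum_eq_single i]
  · change BB.toHom (t i) _ (C.E (C.gen i) i) = _
    rw [E_gen_self, BB.toHom_one]
  · intro j _ hj
    change BB.toHom (t j) _ (C.E (C.gen i) j) = _
    rw [C.E_gen_ne hj, map_zero]
  · simp

/-- Permutation modules are projective. -/
theorem exists_lift {M : BModS} (C : PermCoords M) {Y Z : BModS} (q : Y ⟶ Z) (hq : Function.Surjective (fn q)) (u : M ⟶ Z) :
    ∃ v : M ⟶ Y, v ≫ q = u := by
  choose s hs using fun i => hq (fn u (C.gen i))
  -- Chosen preimages need not be equivariant. Adding the conjugate choice makes them so, and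
  -- idempotence keeps the image unchanged.
  refine ⟨C.lift (fun i => s i + Y.σ (s (C.τ i))) fun i => ?_, ?_⟩
  · rw [C.τ_τ, map_add, Y.σ_σ, add_comm]
  · refine BModS.hom_ext fun x => DFunLike.congr_fun (C.hom_ext fun i => ?_) x
    rw [fn_comp, lift_gen, map_add, fn_σ, hs, hs, ← fn_σ, C.σ_gen, C.τ_τ, Z.add_self]

/-- Permutation modules are injective. -/
theorem exists_extend {M : BModS} (C : PermCoords M) {A B : BModS} (m : A ⟶ B) (hm : Function.Injective (fn m)) (u : A ⟶ M) :
    ∃ v : B ⟶ M, m ≫ v = u := by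
  let c (i : C.X) : A.carrier →+ BB :=
    (Pi.evalAddMonoidHom (fun _ => BB) i).comp (C.E.toAddMonoidHom.comp (fn u))
  have hc : ∀ i x, c i (A.σ x) = c (C.τ i) x := fun i x => by
    change C.E (fn u (A.σ x)) i = C.E (fn u x) (C.τ i)
    rw [fn_σ, C.E_σ]
  -- The extension involves no choice, so it inherits equivariance: conjugating the witness `l`
  -- suffices.
  have hσ : ∀ {i b}, BB.extend B.add_self (fn m) (c (C.τ i)) b = 0 →
      BB.extend B.add_self (fn m) (c i) (B.σ b) = 0 := fun {i b} h => by
    obtain ⟨l, h1, h2⟩ := (BB.extend_eq_zero_iff _ _ _ _).1 h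
    refine (BB.extend_eq_zero_iff _ _ _ _).2 ⟨A.σ l, ?_, ?_⟩
    · rw [hc, h1]
    · rw [fn_σ, ← map_add, h2]
  let v : B.carrier →+ (C.X → BB) :=
    AddMonoidHom.pi fun i => BB.extend B.add_self (fn m) (c i)
  refine ⟨mk' (C.E.symm.toAddMonoidHom.comp v) fun b => C.ext fun i => ?_, ?_⟩
  · rw [C.E_σ]
    change C.E (C.E.symm (v (B.σ b))) i = C.E (C.E.symm (v b)) (C.τ i)
    rw [C.E.apply_symm_apply, C.E.apply_symm_apply]
    refine BB.eq_of_zero_iff ⟨fun h => ?_, hσ⟩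
    have h' : BB.extend B.add_self (fn m) (c (C.τ (C.τ i))) (B.σ b) = 0 := by
      rw [C.τ_τ]
      exact h
    have := hσ h'
    rwa [B.σ_σ] at this
  · refine BModS.hom_ext fun a => C.ext fun i => ?_
    change C.E (C.E.symm (v (fn m a))) i = _
    rw [C.E.apply_symm_apply]
    exact BB.extend_apply B.add_self (fn m) hm (c i) a

/-- The meet with a fixed element `k`. -/
def mask (k : M.carrier) (hk : M.σ k = k) : M ⟶ M :=
  mk' { toFun := fun x => C.E.symm fun i => BB.and (C.E x i) (C.E k i)
        map_zero' := C.ext fun i => by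
          rw [C.E.apply_symm_apply, map_zero]
          exact BB.zero_and _
        map_add' := fun x y => C.ext fun i => by
          simp only [map_add, C.E.apply_symm_apply, Pi.add_apply]
          exact BB.add_and _ _ _ }
    (fun x => C.ext fun i => by
      rw [C.E_σ]
      simp only [AddMonoidHom.coe_mk, ZeroHom.coe_mk, C.E.apply_symm_apply]
      rw [C.E_σ, ← C.E_σ k, hk])

theorem E_mask (k : M.carrier) (hk : M.σ k = k) (x : M.carrier) (i : C.X) :
    C.E (fn (C.mask k hk) x) i = BB.and (C.E x i) (C.E k i) :=
  congrFun (C.E.apply_symm_apply _) i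

/-- The meet of `k` and `σ k`. -/
def symPart (k : M.carrier) : M.carrier :=
  C.E.symm fun i => BB.and (C.E k i) (C.E k (C.τ i))

theorem E_symPart (k : M.carrier) (i : C.X) :
    C.E (C.symPart k) i = BB.and (C.E k i) (C.E k (C.τ i)) :=
  congrFun (C.E.apply_symm_apply _) i

theorem σ_symPart (k : M.carrier) : M.σ (C.symPart k) = C.symPart k :=
  C.ext fun i => by
    rw [C.E_σ, E_symPart, E_symPart, C.τ_τ]
    exact BB.and_comm _ _

end PermCoords

/-! ## Quotients of permutation modules by a relation `r = σ r` -/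

/-- The sequence `α` presents `α.N` as the quotient of a permutation module by a relation
`r = σ r`, where `r` is large in the sense of `le_or` and `not_le`. -/
structure Presentation (α : Seq) extends PermCoords α.M where
  r : α.M.carrier
  p_r : α.N.σ (fn α.p r) = fn α.p r
  desc : ∀ {Y : BModS} (g : α.M ⟶ Y), Y.σ (fn g r) = fn g r → ∃ h, α.p ≫ h = g
  -- `le_or` lets maps be compared on elements below `r` only; `not_le` makes `p` reflect the order
  -- below a basis element; `fixed` limits the overlap of `r` and `σ r` to fixed basis elements.
  le_or : ∀ i, E r i = 1 ∨ E r (τ i) = 1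
  not_le : ∀ i, ∃ j, j ≠ i ∧ E r j = 1
  fixed : ∀ i, E r i = 1 → E r (τ i) = 1 → τ i = i
  exists_not_fixed : ∃ i, τ i ≠ i

/-! ### Symmetrization and independence of the extension -/

/-- An element above `f a` absorbs `f a`, and the cokernel identifies `f a` with its conjugate. -/
theorem cok_add_σ {A B : BModS} (f : A ⟶ B) (a : A.carrier) (b : B.carrier)
    (h : fn f a + b = b) : fn (cok f) b = fn (cok f) (b + B.σ (fn f a)) := by
  have hn : fn (cok f) (B.σ (fn f a)) = fn (cok f) (fn f a) :=
    (fn_σ (cok f) _).trans (null_cok f a)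
  rw [map_add, hn, ← map_add, add_comm, h]

namespace Presentation

variable {α : Seq} (C : Presentation α)

/-- The values `f + σ (f ∧ k ∧ σ k)`, with `k = f r`, for an endomorphism `f` of `α`, do not
change the class of `f` in the cokernel. -/
theorem exists_symmetrized (f : Seq.Hom α α) :
    ∃ n : α.N ⟶ α.N,
      fn (cok ((iHom α.N).map α.p)) f.τN.val = fn (cok ((iHom α.N).map α.p)) n.val ∧
      ∀ y, fn n (fn α.p y) = fn α.p (fn f.τM y + α.M.σ (fn (C.mask (C.symPart (fn f.τM C.r))
        (C.σ_symPart _)) (fn f.τM y))) := by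
  let k := fn f.τM C.r
  let x : α.M ⟶ α.M := f.τM ≫ C.mask (C.symPart k) (C.σ_symPart k)
  -- Since `x r = k ∧ (k ∧ σ k)` is symmetric, `x` respects the relation and descends to `N`.
  have hx : α.M.σ (fn x C.r) = fn x C.r := by
    have : fn x C.r = C.symPart k := C.ext fun i => by
      change C.E (fn (C.mask (C.symPart k) (C.σ_symPart k)) k) i = _
      rw [C.E_mask, C.E_symPart]
      exact BB.and_and_self _ _
    rw [this, C.σ_symPart]
  obtain ⟨z, hz⟩ := C.desc x hx
  have hz' : ∀ y, fn z (fn α.p y) = fn x y := fun y => congrArg (fun t => fn t y) hz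
  have hf : ∀ y, fn f.τN (fn α.p y) = fn α.p (fn f.τM y) :=
    fun y => congrArg (fun t => fn t y) f.comm_p
  let a : ((iHom α.N).obj α.N).carrier := f.τN.val
  let n : ((iHom α.N).obj α.N).carrier := a + ((iHom α.N).obj α.N).σ (fn ((iHom α.N).map α.p) z.val)
  refine ⟨⟨n⟩, ?_, fun y => ?_⟩
  · refine cok_add_σ ((iHom α.N).map α.p) z.val f.τN.val ?_
    refine Subtype.ext (AddMonoidHom.ext fun b => ?_)
    obtain ⟨y, rfl⟩ := α.isCokernel.surjective b
    change fn α.p (fn z (fn α.p y)) + fn f.τN (fn α.p y) = fn f.τN (fn α.p y)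
    rw [hz', hf, ← map_add]
    congr 1
    refine C.ext fun i => ?_
    rw [map_add, Pi.add_apply]
    change C.E (fn (C.mask _ (C.σ_symPart k)) (fn f.τM y)) i + _ = _
    rw [C.E_mask]
    exact BB.and_add_self _ _
  · change fn f.τN (fn α.p y) + α.N.σ (fn α.p (fn z (fn α.p y))) = _
    rw [hf, hz', map_add, fn_σ]
    rfl

/-- The symmetrized representatives of `f` and `g` coincide, because they depend only on the
restriction to `Ker p`. -/
theorem cok_eq_of_left_eq {α : Seq} (C : Presentation α) (f g : Seq.Hom α α) (h : f.τL = g.τL) :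
    fn (cok ((iHom α.N).map α.p)) f.τN.val = fn (cok ((iHom α.N).map α.p)) g.τN.val := by
  have hK : ∀ y, α.N.σ (fn α.p y) = fn α.p y → fn f.τM y = fn g.τM y := fun y hy => by
    obtain ⟨l, rfl⟩ := α.isKernel.exists_of_fixed hy
    have h1 : fn f.τM (fn α.m l) = fn α.m (fn f.τL l) := congrArg (fun t => fn t l) f.comm_m
    have h2 : fn g.τM (fn α.m l) = fn α.m (fn g.τL l) := congrArg (fun t => fn t l) g.comm_m
    rw [h1, h2, h]
  obtain ⟨n, hn, hn'⟩ := C.exists_symmetrized f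
  obtain ⟨n', hm, hm'⟩ := C.exists_symmetrized g
  rw [hn, hm]
  congr 1
  refine Subtype.ext (AddMonoidHom.ext fun b => ?_)
  obtain ⟨y, rfl⟩ := α.isCokernel.surjective b
  refine (hn' y).trans (Eq.trans ?_ (hm' y).symm)
  congr 1
  have hr : fn g.τM C.r = fn f.τM C.r := (hK _ C.p_r).symm
  simp only [hr]
  set k := fn f.τM C.r
  let x := C.mask (C.symPart k) (C.σ_symPart k)
  -- Here `f y` and `g y` lie below `k`, while `y + σ y` lies in `Ker p`, where `f` and `g` agree;
  -- the rest is a Boolean identity in coordinates `i` and `τ i`.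
  have hle : ∀ y, y + C.r = C.r → fn f.τM y + α.M.σ (fn x (fn f.τM y)) =
      fn g.τM y + α.M.σ (fn x (fn g.τM y)) := fun y hy => C.ext fun i => by
    have h1 : fn f.τM y + k = k := by rw [← map_add, hy]
    have h2 : fn g.τM y + k = k := by rw [← hr, ← map_add, hy]
    have h3 : fn f.τM y + α.M.σ (fn f.τM y) = fn g.τM y + α.M.σ (fn g.τM y) := by
      rw [← fn_σ, ← fn_σ, ← map_add, ← map_add]
      refine hK _ ?_
      rw [map_add, map_add, fn_σ, α.N.σ_σ, add_comm]
    have e1 : ∀ j, C.E (fn f.τM y) j + C.E k j = C.E k j := fun j => by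
      rw [← Pi.add_apply, ← map_add, h1]
    have e2 : ∀ j, C.E (fn g.τM y) j + C.E k j = C.E k j := fun j => by
      rw [← Pi.add_apply, ← map_add, h2]
    have e3 : C.E (fn f.τM y) i + C.E (fn f.τM y) (C.τ i) =
        C.E (fn g.τM y) i + C.E (fn g.τM y) (C.τ i) := by
      rw [← C.E_σ, ← C.E_σ, ← Pi.add_apply, ← Pi.add_apply, ← map_add, ← map_add, h3]
    rw [map_add, map_add, Pi.add_apply, Pi.add_apply, C.E_σ, C.E_σ, C.E_mask, C.E_mask,
      C.E_symPart, C.τ_τ]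
    exact BB.symmetrized_eq _ _ _ _ _ _ (e1 _) (e1 _) (e2 _) (e2 _) e3
  have hom : (fn f.τM + α.M.σ.comp ((fn x).comp (fn f.τM))) =
      (fn g.τM + α.M.σ.comp ((fn x).comp (fn g.τM))) := by
    refine C.hom_ext fun i => ?_
    change fn f.τM (C.gen i) + α.M.σ (fn x (fn f.τM (C.gen i))) =
      fn g.τM (C.gen i) + α.M.σ (fn x (fn g.τM (C.gen i)))
    rcases C.le_or i with hi | hi
    · exact hle _ (C.add_gen_of_apply_eq_one hi)
    · have := congrArg α.M.σ (hle _ (C.add_gen_of_apply_eq_one hi))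
      rw [← C.σ_gen] at this
      simpa only [map_add, fn_σ, α.M.σ_σ] using this
  exact DFunLike.congr_fun hom y

theorem isIso_satelliteMap {α : Seq} (C : Presentation α)
    (P : ObjectProperty Seq) [ObjectProperty.EssentiallySmall.{0} P]
    (hα : P α) : IsIso (satelliteMap P (iHom α.N) α hα) := by
  refine BModS.isIso_satelliteMap P _ α hα (fun c x => ?_) (fun c f g h => ?_)
  · obtain ⟨v, hv⟩ := C.exists_extend c.m c.isKernel.injective (x ≫ α.m)
    obtain ⟨g, hg, -⟩ := Seq.exists_hom_of_left x v hv
    exact ⟨g, hg⟩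
  · refine cok_hom_ext (BModS.hom_ext fun u => ?_)
    -- An element of `Hom(N, c'')` is a morphism. Lifting it to `α → c` by projectivity turns both
    -- extensions into endomorphisms of `α`.
    let u' : α.N ⟶ c.N := ⟨u⟩
    obtain ⟨v, hv⟩ := C.exists_lift c.p c.isCokernel.surjective (α.p ≫ u')
    obtain ⟨t, ht, -⟩ := Seq.exists_hom_of_right u' v hv.symm
    let t' : α ⟶ c := t
    have := C.cok_eq_of_left_eq (t' ≫ f) (t' ≫ g) (congrArg (t.τL ≫ ·) h)
    change fn (cok ((iHom α.N).map α.p)) (t.τN ≫ f.τN).val =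
      fn (cok ((iHom α.N).map α.p)) (t.τN ≫ g.τN).val at this
    rw [ht] at this
    exact this

/-! ### Non-nullity of the cokernel -/

open Classical in
-- The character vanishing exactly below `gen i`, paired with its conjugate, takes the fixed value
-- `(1, 1)` at `r` by `not_le`; it therefore factors through `p` and tests the inequality in `N`.
theorem le_gen_of_p_le {v : α.M.carrier} {i : C.X}
    (h : fn α.p v + fn α.p (C.gen i) = fn α.p (C.gen i)) : v + C.gen i = C.gen i := by
  let B : BModS := sObj BB BB.add_self
  let t (j : C.X) : B.carrier := (if j = i then (0 : BB) else 1, if C.τ j = i then (0 : BB) else 1)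
  let g : α.M ⟶ B := C.lift t fun j => by
    change (_, _) = (_, _)
    rw [C.τ_τ]
    rfl
  have hr : fn g C.r = ((1 : BB), (1 : BB)) := by
    obtain ⟨j, hj, hj'⟩ := C.not_le i
    obtain ⟨k, hk, hk'⟩ := C.not_le (C.τ i)
    have h1 : fn g (C.gen j) + fn g C.r = fn g C.r := by
      rw [← map_add, C.add_gen_of_apply_eq_one hj']
    have h2 : fn g (C.gen k) + fn g C.r = fn g C.r := by
      rw [← map_add, C.add_gen_of_apply_eq_one hk']
    rw [C.lift_gen] at h1 h2
    have h1' : (if j = i then (0 : BB) else 1) + (fn g C.r).1 = (fn g C.r).1 :=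
      congrArg Prod.fst h1
    have h2' : (if C.τ k = i then (0 : BB) else 1) + (fn g C.r).2 = (fn g C.r).2 :=
      congrArg Prod.snd h2
    rw [if_neg hj, BB.one_add] at h1'
    rw [if_neg, BB.one_add] at h2'
    · exact Prod.ext h1'.symm h2'.symm
    · rintro rfl
      exact hk (C.τ_τ k).symm
  obtain ⟨q, hq⟩ := C.desc g (by rw [hr]; rfl)
  have hg : fn g v + fn g (C.gen i) = fn g (C.gen i) := by
    have := congrArg (fn q) h
    rw [map_add, ← fn_comp, ← fn_comp, hq] at this
    exact this
  refine C.ext fun j => ?_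
  rw [map_add, Pi.add_apply]
  rcases BB.eq_zero_or_one (C.E v j) with h0 | h1
  · rw [h0, zero_add]
  · by_cases hj : j = i
    · rw [hj, C.E_gen_self, BB.add_one]
    · exfalso
      have h2 : fn g (C.gen j) + fn g v = fn g v := by
        rw [← map_add, C.add_gen_of_apply_eq_one h1]
      rw [C.lift_gen] at h2 hg
      have h3 : (if j = i then (0 : BB) else 1) + (fn g v).1 = (fn g v).1 := congrArg Prod.fst h2
      have h4 : (fn g v).1 + (if i = i then (0 : BB) else 1) = (if i = i then (0 : BB) else 1) :=
        congrArg Prod.fst hg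
      rw [if_neg hj, BB.one_add] at h3
      rw [if_pos rfl, ← h3] at h4
      exact BB.one_ne_zero h4

/-- The composite `w = y ∘ p` lies below the identity, so it keeps or kills each basis element. If
it keeps `gen i`, then the symmetric element `w r ≤ r` contains both `i` and `τ i`, which forces `τ
i = i`. -/
theorem σ_eq_of_comp_le_id {α : Seq} (C : Presentation α) (y : α.N ⟶ α.M) (h : ∀ x, fn α.p (fn y x) + x = x) (x : α.N.carrier) :
    α.M.σ (fn y x) = fn y x := by
  let w : α.M ⟶ α.M := α.p ≫ y
  have hgen : ∀ i, fn w (C.gen i) + C.gen i = C.gen i := fun i => C.le_gen_of_p_le (h _)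
  have hle : ∀ x, fn w x + x = x := DFunLike.congr_fun
    (C.hom_ext (f := fn w + AddMonoidHom.id _) (g := AddMonoidHom.id _) hgen)
  have hr : α.M.σ (fn w C.r) = fn w C.r := by
    change α.M.σ (fn y (fn α.p C.r)) = fn y (fn α.p C.r)
    rw [← fn_σ, C.p_r]
  have hEr : ∀ j, C.E (fn w C.r) (C.τ j) = C.E (fn w C.r) j := fun j => by
    rw [← C.E_σ, hr]
  have hle_r : ∀ j, C.E (fn w C.r) j = 1 → C.E C.r j = 1 := fun j hj => by
    rw [← hle C.r, map_add, Pi.add_apply, hj, BB.one_add]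
  have hself : ∀ i, C.E (fn w (C.gen i)) i = 1 → C.E C.r i = 1 → C.E (fn w C.r) i = 1 :=
    fun i hi hri => by
      rw [← C.add_gen_of_apply_eq_one hri, map_add, map_add, Pi.add_apply, hi, BB.one_add]
  have key : ∀ i, α.M.σ (fn w (C.gen i)) = fn w (C.gen i) := fun i => by
    rcases BB.eq_zero_or_one (C.E (fn w (C.gen i)) i) with h0 | h1
    · have : fn w (C.gen i) = 0 := C.ext fun j => by
        rw [map_zero, Pi.zero_apply]
        by_cases hj : j = i
        · rw [hj, h0]
        · have := congrArg (fun t => C.E t j) (hgen i)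
          simp only [map_add, Pi.add_apply, C.E_gen_ne hj, add_zero] at this
          exact this
      rw [this, map_zero]
    · have h1' : C.E (fn w (C.gen (C.τ i))) (C.τ i) = 1 := by
        rw [← C.σ_gen, fn_σ, C.E_σ, C.τ_τ, h1]
      have hi : C.E (fn w C.r) i = 1 := by
        rcases C.le_or i with hi | hi
        · exact hself i h1 hi
        · rw [← hEr]
          exact hself _ h1' hi
      have hτ : C.τ i = i := C.fixed i (hle_r _ hi) (hle_r _ ((hEr i).trans hi))
      rw [← fn_σ, C.σ_gen, hτ]
  obtain ⟨v, rfl⟩ := α.isCokernel.surjective x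
  exact DFunLike.congr_fun
    (C.hom_ext (f := α.M.σ.comp (fn w)) (g := fn w) key) v

open Classical in
theorem not_isNullObj {α : Seq} (C : Presentation α) :
    ¬ IsNullObj (Coker ((iHom α.N).map α.p)) := by
  intro hnull
  let H := (iHom α.N).obj α.N
  let one : H.carrier := (𝟙 α.N : α.N ⟶ α.N).val
  -- Extending the zero map along `1 ↦ id` gives the character that vanishes exactly below `id`.
  let χ : H.carrier →+ BB :=
    BB.extend H.add_self (BB.toHom one (H.add_self one)) 0
  have hχ : ∀ x, χ x = 0 ↔ x + one = one := fun x => by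
    rw [BB.extend_eq_zero_iff]
    constructor
    · rintro ⟨l, -, hl⟩
      rcases BB.eq_zero_or_one l with rfl | rfl
      · rw [map_zero, add_zero] at hl
        rw [hl, zero_add]
      · rwa [BB.toHom_one] at hl
    · exact fun h => ⟨1, rfl, by rwa [BB.toHom_one]⟩
  let g : H ⟶ sObj BB BB.add_self := mk' (χ.prod (χ.comp H.σ)) fun x =>
    Prod.ext rfl (congrArg χ (H.σ_σ x))
  have hfix : ∀ y : ((iHom α.N).obj α.M).carrier, χ (fn ((iHom α.N).map α.p) y) = 0 →
      H.σ (fn ((iHom α.N).map α.p) y) = fn ((iHom α.N).map α.p) y := fun y hy => by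
    have h1 := (hχ _).1 hy
    have h2 := C.σ_eq_of_comp_le_id ⟨y⟩ fun x => congrArg (fun t : homs α.N α.N => t.1 x) h1
    rw [← fn_σ]
    exact congrArg _ (Subtype.ext (AddMonoidHom.ext h2))
  -- If `χ` vanishes at `p y` or at its conjugate, then `p y` is fixed; so the two components of `g`
  -- always agree there.
  have hg : IsNull ((iHom α.N).map α.p ≫ g) := fun y => by
    have : χ (H.σ (fn ((iHom α.N).map α.p) y)) = χ (fn ((iHom α.N).map α.p) y) := by
      refine BB.eq_of_zero_iff ⟨fun h => ?_, fun h => by rw [hfix y h, h]⟩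
      rw [← fn_σ] at h
      have := hfix _ h
      rw [fn_σ, H.σ_σ] at this
      rw [this, ← fn_σ, h]
    exact Prod.ext this this.symm
  have h1 : fn g (H.σ one) = fn g one := by
    have := hnull (fn (cok ((iHom α.N).map α.p)) one)
    rw [← fn_σ] at this
    exact congrArg (fn (cokDesc _ g hg)) this
  have h2 : χ (H.σ one) = χ one := congrArg Prod.fst h1
  rw [(hχ one).2 (H.add_self one), hχ] at h2
  -- Nullity would give `σ ≤ id` on `N`, hence `gen (τ i) ≤ gen i` in `M`, which is absurd when `τ i
  -- ≠ i`.
  obtain ⟨i, hi⟩ := C.exists_not_fixed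
  have h3 : α.N.σ (fn α.p (C.gen i)) + fn α.p (C.gen i) = fn α.p (C.gen i) :=
    congrArg (fun t : homs α.N α.N => t.1 (fn α.p (C.gen i))) h2
  rw [← fn_σ, C.σ_gen] at h3
  have h4 := congrArg (fun t => C.E t (C.τ i)) (C.le_gen_of_p_le h3)
  simp only [map_add, Pi.add_apply, C.E_gen_self, BB.one_add, C.E_gen_ne hi] at h4
  exact BB.one_ne_zero h4

/-- The satellite of `Hom(α'', -)` is not null. -/
theorem satellite_not_null {α : Seq} (C : Presentation α) (P : ObjectProperty Seq)
    [ObjectProperty.EssentiallySmall.{0} P] (hα : P α) :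
    ¬ IsNullFunctor (satellite P (iHom α.N)) := fun h => by
  have := C.isIso_satelliteMap P hα
  exact C.not_isNullObj (isNullObj_of_iso (asIso (satelliteMap P (iHom α.N) α hα)) (h _))

end Presentation

/-! ## The two sequences -/

/-- The basis of `𝔹² × 𝔹²`. -/
def coordsB22 : PermCoords B22 where
  X := Bool × Bool
  τ i := (!i.1, i.2)
  τ_τ := by decide
  E :=
    { toFun := fun x i => bif i.1 then (bif i.2 then x.1.1 else x.1.2) else
        (bif i.2 then x.2.1 else x.2.2)
      invFun := fun f => ((f (true, true), f (true, false)), (f (false, true), f (false, false)))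
      left_inv := fun _ => rfl
      right_inv := fun f => funext fun i => by rcases i with ⟨_ | _, _ | _⟩ <;> rfl
      map_add' := fun _ _ => funext fun i => by rcases i with ⟨_ | _, _ | _⟩ <;> rfl }
  E_σ _ i := by rcases i with ⟨_ | _, _ | _⟩ <;> rfl

/-- The only elements of `𝔰𝔹` that are not fixed are `(1, 0)` and its conjugate, so testing on `(1,
0)` is enough. -/
theorem isNull_sDiag_comp {Y : BModS} (g : B22 ⟶ Y)
    (hg : Y.σ (fn g (((1, 1), (0, 0)) : (BB × BB) × (BB × BB))) =
      fn g (((1, 1), (0, 0)) : (BB × BB) × (BB × BB))) : IsNull (sDiag ≫ g) := by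
  rintro ⟨x, y⟩
  change Y.σ (fn g (((x, x), (y, y)) : (BB × BB) × (BB × BB))) =
    fn g (((x, x), (y, y)) : (BB × BB) × (BB × BB))
  have hr : fn g (((0, 0), (1, 1)) : (BB × BB) × (BB × BB)) =
      fn g (((1, 1), (0, 0)) : (BB × BB) × (BB × BB)) := (fn_σ g _).trans hg
  refine (fn_σ g _).symm.trans ?_
  change fn g (((y, y), (x, x)) : (BB × BB) × (BB × BB)) = _
  rcases BB.eq_zero_or_one x with rfl | rfl <;> rcases BB.eq_zero_or_one y with rfl | rfl
  exacts [rfl, hr.symm, hr, rfl]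

/-- `Q` is the quotient of `𝔹² × 𝔹²` by the relation `r = σ r` for `r = ((1, 1), (0, 0))`. -/
def presentationQ : Presentation seqQ where
  toPermCoords := coordsB22
  r := (((1, 1), (0, 0)) : (BB × BB) × (BB × BB))
  p_r := null_cok sDiag ((1, 0) : BB × BB)
  desc g hg := ⟨cokDesc _ g (isNull_sDiag_comp g hg), rfl⟩
  le_or i := by rcases i with ⟨_ | _, _ | _⟩ <;> first | exact Or.inl rfl | exact Or.inr rfl
  -- The support of `r` is the pair of indices with first entry `true`; flipping the second entry
  -- gives one different from `i`.
  not_le i := ⟨(true, !i.2), fun h => Bool.not_ne_self i.2 (congrArg Prod.snd h),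
    by rcases i with ⟨_ | _, _ | _⟩ <;> rfl⟩
  -- Vacuous here: `r` and `σ r` have disjoint supports.
  fixed i h h' := by
    rcases i with ⟨_ | _, _ | _⟩
    · exact absurd h BB.one_ne_zero.symm
    · exact absurd h BB.one_ne_zero.symm
    · exact absurd h' BB.one_ne_zero.symm
    · exact absurd h' BB.one_ne_zero.symm
  exists_not_fixed := ⟨(true, true), fun h => Bool.noConfusion (congrArg Prod.fst h)⟩

/-- The basis of `𝔹³`. -/
def coordsB3 : PermCoords B3 where
  X := Fin 3
  τ := Fin.rev
  τ_τ := Fin.rev_rev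
  E := AddEquiv.refl _
  E_σ _ _ := rfl

/-- `S` is the quotient of `𝔹³` by the relation `r = σ r` for `r = a + b`. -/
def presentationS : Presentation seqS where
  toPermCoords := coordsB3
  r := e 0 + e 1
  p_r := by
    change S.σ (fn φ (e 0 + e 1)) = fn φ (e 0 + e 1)
    rw [← fn_σ, B3_σ]
    exact testProj_eq_iff.2 fun _ _ h => h.symm
  desc g hg := ⟨testDesc g (by
    rw [← B3_σ]
    exact hg.symm.trans (fn_σ g _).symm), rfl⟩
  le_or := by
    change ∀ i : Fin 3, (Pi.single 0 1 + Pi.single 1 1 : Fin 3 → BB) i = 1 ∨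
      (Pi.single 0 1 + Pi.single 1 1 : Fin 3 → BB) i.rev = 1
    decide
  not_le := by
    change ∀ i : Fin 3, ∃ j : Fin 3, j ≠ i ∧ (Pi.single 0 1 + Pi.single 1 1 : Fin 3 → BB) j = 1
    decide
  -- Here `r = a + b` and `σ r = b + c` overlap only in the fixed generator `b`.
  fixed := by
    change ∀ i : Fin 3, (Pi.single 0 1 + Pi.single 1 1 : Fin 3 → BB) i = 1 →
      (Pi.single 0 1 + Pi.single 1 1 : Fin 3 → BB) i.rev = 1 → i.rev = i
    decide
  exists_not_fixed := ⟨(0 : Fin 3), show Fin.rev (0 : Fin 3) ≠ 0 by decide⟩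

end BModS

open BModS in
theorem mainTheorem6 (P : ObjectProperty BModS.Seq) [ObjectProperty.EssentiallySmall.{0} P]
    (hP : finiteSeq ≤ P) :
    (¬ IsNullFunctor (satellite P (iHom Q)) ∧
      IsIso (satelliteMap P (iHom Q) seqQ (hP _ finiteSeq_seqQ)) ∧
      ¬ IsNullObj (Coker ((iHom Q).map (cok sDiag)))) ∧
    (¬ IsNullFunctor (satellite P (iHom S)) ∧
      IsIso (satelliteMap P (iHom S) seqS (hP _ finiteSeq_seqS)) ∧
      ¬ IsNullObj (Coker ((iHom S).map φ))) :=
  ⟨⟨presentationQ.satellite_not_null P (hP _ finiteSeq_seqQ),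
      presentationQ.isIso_satelliteMap P (hP _ finiteSeq_seqQ), presentationQ.not_isNullObj⟩,
    ⟨presentationS.satellite_not_null P (hP _ finiteSeq_seqS),
      presentationS.isIso_satelliteMap P (hP _ finiteSeq_seqS), presentationS.not_isNullObj⟩⟩
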